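/- For positive integers $s_1\ge 2$ and $s_2,\dots,s_k\ge 1$ let \[ \zeta(s_1,\dots,s_k)=\sum_{n_1>n_2>\cdots>n_k>0}\ \prod_{j=1}^k n_j^{-s_j} \] denote the multiple zeta value, the sum being over integers $n_1>\cdots>n_k>0$, and write $\{1\}^n$ for the string consisting of $n$ ones, so that $\zeta(s,\{1\}^n)$ has depth $n+1$. Let $s\ge 2$ and $n\ge 0$ be integers. Then the series defining $\zeta(s,\{1\}^n)$ converges absolutely, and \[ \zeta(s,\{1\}^n)\in\mathbf{Q}[\zeta(2),\zeta(3),\dots,\zeta(s+n)], \] the $\mathbf{Q}$-algebra generated by the Riemann zeta values $\zeta(2),\dots,\zeta(s+n)$. More precisely, $\zeta(s,\{1\}^n)$ is a rational linear combination of products $\zeta(k_1)\cdots\zeta(k_r)$ of Riemann zeta values at integers $k_i\ge 2$ with $k_1+\cdots+k_r=s+n$. -/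

import Mathlib

/-- The index set of a nested sum of depth `k`: all tuples of integers
`n₁ > n₂ > ⋯ > n_k > 0`. -/
def NestedIndex (k : ℕ) : Type :=
  {n : Fin k → ℕ // StrictAnti n ∧ ∀ j, 0 < n j}

/-- The summand `∏ⱼ nⱼ ^ (-sⱼ)` of a multiple zeta value with arguments `s₁, …, s_k`. -/
noncomputable def multipleZetaTerm {k : ℕ} (s : Fin k → ℕ) (n : NestedIndex k) : ℂ :=
  ∏ j, ((n.1 j : ℂ) ^ s j)⁻¹

/-- The multiple zeta value `ζ(s₁, …, s_k) = ∑_{n₁ > ⋯ > n_k > 0} ∏ⱼ nⱼ ^ (-sⱼ)`. -/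
noncomputable def multipleZeta {k : ℕ} (s : Fin k → ℕ) : ℂ :=
  ∑' n : NestedIndex k, multipleZetaTerm s n

/-- The argument list `s, {1}^n`, that is, `s` followed by `n` ones. -/
def consOnes (s n : ℕ) : Fin (n + 1) → ℕ :=
  Fin.cons s fun _ => 1

/-- The products `ζ(k₁) ⋯ ζ(k_r)` of Riemann zeta values at integers `kᵢ ≥ 2` with
`k₁ + ⋯ + k_r = w`. -/
def zetaProducts (w : ℕ) : Set ℂ :=
  {z | ∃ K : Multiset ℕ, (∀ k ∈ K, 2 ≤ k) ∧ K.sum = w ∧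
    z = (K.map fun k : ℕ => riemannZeta (k : ℂ)).prod}

/-! The values `ζ(m+2,{1}^n)` are read off from a generating function. The coefficient of `x^(m+1)
y^(n+1)` in the Gauss series `₂F₁(-x, y; 1-x; 1)` is `-ζ(m+2,{1}^n)`, because `(-x)_N / (1-x)_N`
collapses to `-x/(N-x)` and `(y)_N / N!` expands into elementary symmetric functions of `1/j`
(`hasSum_coeff_term`, `hasSum_multipleZetaTerm`). Gauss's theorem evaluates the series as `∏
k(k-x-y)/((k-x)(k-y))`. It is proved for formal series with coefficientwise convergence:
`tsum_term_contiguous` relates the lower parameters `M+1-x` and `M+2-x`, and the sum tends to 1 as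
`M → ∞`. The logarithmic `x`-derivative of the product has coefficients that are integer multiples
of single zeta values. Solving the resulting recursion gives coefficients homogeneous in weight
(`exists_tendsto_coeff_gammaProd`). -/

open PowerSeries Filter Topology
open scoped PowerSeries.WithPiTopology

/-! ### Truncated weighted seminorms, finite on every power series. -/

/-- The weighted `ℓ¹` seminorm of the truncation of a power series at degree `K`. -/
noncomputable def PowerSeries.truncSeminorm {R : Type*} [CommRing R] (ν : RingSeminorm R)
    (r : ℝ) (hr : 0 ≤ r) (K : ℕ) : RingSeminorm R⟦X⟧ where
  toFun p := ∑ i ∈ Finset.range (K + 1), ν (coeff i p) * r ^ i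
  map_zero' := by simp
  neg' p := by simp
  add_le' p q := by
    rw [← Finset.sum_add_distrib]
    refine Finset.sum_le_sum fun i _ => ?_
    rw [← add_mul, map_add]
    exact mul_le_mul_of_nonneg_right (map_add_le_add ν _ _) (by positivity)
  mul_le' p q := by
    have h0 : ∀ (p : R⟦X⟧) (i : ℕ), 0 ≤ ν (coeff i p) * r ^ i := fun p i =>
      mul_nonneg (apply_nonneg ν _) (by positivity)
    calc ∑ i ∈ Finset.range (K + 1), ν (coeff i (p * q)) * r ^ i
        ≤ ∑ i ∈ Finset.range (K + 1), ∑ a ∈ Finset.HasAntidiagonal.antidiagonal i,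
            (ν (coeff a.1 p) * r ^ a.1) * (ν (coeff a.2 q) * r ^ a.2) := by
          refine Finset.sum_le_sum fun i _ => ?_
          rw [coeff_mul]
          calc _ ≤ (∑ a ∈ Finset.HasAntidiagonal.antidiagonal i, ν (coeff a.1 p * coeff a.2 q)) * r ^ i := by
                refine mul_le_mul_of_nonneg_right ?_ (by positivity)
                exact Finset.le_sum_of_subadditive ν (map_zero ν).le (map_add_le_add ν) _ _
            _ ≤ _ := by
                rw [Finset.sum_mul]
                refine Finset.sum_le_sum fun a ha => ?_
                rw [← Finset.HasAntidiagonal.mem_antidiagonal.1 ha, pow_add]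
                calc _ ≤ (ν (coeff a.1 p) * ν (coeff a.2 q)) * (r ^ a.1 * r ^ a.2) :=
                      mul_le_mul_of_nonneg_right (map_mul_le_mul ν _ _) (by positivity)
                  _ = _ := by ring
      _ ≤ ∑ a ∈ Finset.range (K + 1) ×ˢ Finset.range (K + 1),
            (ν (coeff a.1 p) * r ^ a.1) * (ν (coeff a.2 q) * r ^ a.2) := by
          rw [← Finset.sum_biUnion]
          · refine Finset.sum_le_sum_of_subset_of_nonneg (fun a ha => ?_)
              fun a _ _ => mul_nonneg (h0 _ _) (h0 _ _)
            obtain ⟨i, hi, ha⟩ := Finset.mem_biUnion.1 ha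
            rw [Finset.HasAntidiagonal.mem_antidiagonal] at ha
            rw [Finset.mem_range] at hi
            rw [Finset.mem_product, Finset.mem_range, Finset.mem_range]
            omega
          · intro i _ j _ hij
            refine Finset.disjoint_left.2 fun a ha hb => hij ?_
            rw [Finset.HasAntidiagonal.mem_antidiagonal] at ha hb
            exact ha.symm.trans hb
      _ = _ := by rw [Finset.sum_product, Finset.sum_mul_sum]

lemma PowerSeries.truncSeminorm_apply {R : Type*} [CommRing R] (ν : RingSeminorm R)
    (r : ℝ) (hr : 0 ≤ r) (K : ℕ) (p : R⟦X⟧) :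
    truncSeminorm ν r hr K p = ∑ i ∈ Finset.range (K + 1), ν (coeff i p) * r ^ i := rfl

lemma PowerSeries.truncSeminorm_C {R : Type*} [CommRing R] (ν : RingSeminorm R)
    (r : ℝ) (hr : 0 ≤ r) (K : ℕ) (a : R) : truncSeminorm ν r hr K (C a) = ν a := by
  rw [truncSeminorm_apply, Finset.sum_eq_single 0]
  · simp
  · intro i _ hi
    simp [coeff_C, hi]
  · simp

lemma PowerSeries.truncSeminorm_X_le {R : Type*} [CommRing R] (ν : RingSeminorm R)
    (r : ℝ) (hr : 0 ≤ r) (K : ℕ) : truncSeminorm ν r hr K X ≤ ν 1 * r := by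
  rw [truncSeminorm_apply]
  calc _ = ∑ i ∈ Finset.range (K + 1), if i = 1 then ν 1 * r else 0 := by
        refine Finset.sum_congr rfl fun i _ => ?_
        split_ifs with h
        · simp [h]
        · simp [coeff_X, h]
    _ ≤ _ := by
        rw [Finset.sum_ite_eq']
        split_ifs
        · rfl
        · exact mul_nonneg (apply_nonneg ν _) hr

lemma PowerSeries.coeff_mul_pow_le_truncSeminorm {R : Type*} [CommRing R] (ν : RingSeminorm R)
    (r : ℝ) (hr : 0 ≤ r) (K : ℕ) (p : R⟦X⟧) {i : ℕ} (hi : i ≤ K) :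
    ν (coeff i p) * r ^ i ≤ truncSeminorm ν r hr K p :=
  Finset.single_le_sum (f := fun i => ν (coeff i p) * r ^ i)
    (fun i _ => mul_nonneg (apply_nonneg ν _) (by positivity))
    (Finset.mem_range.2 (Nat.lt_succ_of_le hi))

/-! ### Hypergeometric terms and finite contiguity. -/

namespace GaussSum

/-- Formal power series in two variables `x`, `y`, as series in `x` over series in `y`. -/
abbrev BiSeries : Type := ℝ⟦X⟧⟦X⟧

/-- The first variable. -/
noncomputable abbrev varX : BiSeries := X

/-- The second variable. -/
noncomputable abbrev varY : BiSeries := C X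

/-- The inverse of `k - x`. -/
noncomputable def invX (k : ℕ) : BiSeries := mk fun i => C ((k : ℝ)⁻¹ ^ (i + 1))

/-- The inverse of `k - y`. -/
noncomputable def invY (k : ℕ) : BiSeries := C (mk fun i => (k : ℝ)⁻¹ ^ (i + 1))

/-- The inverse of `k - x - y`. -/
noncomputable def invXY (k : ℕ) : BiSeries :=
  mk fun p => mk fun q => ((p + q).choose p : ℝ) * (k : ℝ)⁻¹ ^ (p + q + 1)

/-- A real scalar as a constant series. -/
noncomputable abbrev scal (a : ℝ) : BiSeries := C (C a)

lemma scal_natCast (k : ℕ) : scal (k : ℝ) = (k : BiSeries) := by simp [scal]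

lemma scal_inv_mul {k : ℕ} (hk : k ≠ 0) : scal (k : ℝ)⁻¹ * (k : BiSeries) = 1 := by
  rw [← scal_natCast, ← map_mul, ← map_mul, inv_mul_cancel₀ (by exact_mod_cast hk), map_one, map_one]

lemma mul_inv_pow_succ_succ {k : ℝ} (hk : k ≠ 0) (i : ℕ) :
    k * k⁻¹ ^ (i + 1 + 1) = k⁻¹ ^ (i + 1) := by
  rw [pow_succ' _ (i + 1), ← mul_assoc, mul_inv_cancel₀ hk, one_mul]

lemma sub_mul_invX {k : ℕ} (hk : k ≠ 0) : ((k : BiSeries) - varX) * invX k = 1 := by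
  have hk' : (k : ℝ) ≠ 0 := by exact_mod_cast hk
  rw [← scal_natCast, sub_mul]
  ext i : 1
  rw [map_sub, coeff_C_mul]
  rcases i with _ | i
  · rw [coeff_zero_X_mul, invX, coeff_mk, ← map_mul]
    simp [mul_inv_cancel₀ hk']
  · rw [coeff_succ_X_mul, invX, coeff_mk, coeff_mk, ← map_mul, ← map_sub,
      show (k : ℝ) * (k : ℝ)⁻¹ ^ (i + 1 + 1) - (k : ℝ)⁻¹ ^ (i + 1) = 0 by rw [mul_inv_pow_succ_succ hk', sub_self]]
    simp [coeff_one]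

lemma sub_mul_invY {k : ℕ} (hk : k ≠ 0) : ((k : BiSeries) - varY) * invY k = 1 := by
  have hk' : (k : ℝ) ≠ 0 := by exact_mod_cast hk
  rw [← scal_natCast, invY, ← map_sub, ← map_mul, ← map_one C]
  congr 1
  rw [sub_mul]
  ext i : 1
  rw [map_sub, coeff_C_mul]
  rcases i with _ | i
  · simp [hk']
  · rw [coeff_succ_X_mul, coeff_mk, coeff_mk,
      show (k : ℝ) * (k : ℝ)⁻¹ ^ (i + 1 + 1) - (k : ℝ)⁻¹ ^ (i + 1) = 0 by rw [mul_inv_pow_succ_succ hk', sub_self]]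
    simp [coeff_one]

lemma sub_mul_invXY {k : ℕ} (hk : k ≠ 0) : ((k : BiSeries) - varX - varY) * invXY k = 1 := by
  have hk' : (k : ℝ) ≠ 0 := by exact_mod_cast hk
  rw [← scal_natCast, sub_mul, sub_mul]
  ext p q
  rw [map_sub, map_sub, map_sub, map_sub, coeff_C_mul, coeff_C_mul, coeff_C_mul]
  rcases p with _ | p <;> rcases q with _ | q
  · simp [invXY, hk']
  · simp only [invXY, coeff_zero_X_mul, coeff_succ_X_mul, coeff_mk, coeff_zero_one]
    simp [coeff_one, mul_inv_pow_succ_succ hk', -inv_pow]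
  · simp only [invXY, coeff_zero_X_mul, coeff_succ_X_mul, coeff_mk]
    simp [coeff_one, mul_inv_pow_succ_succ hk', -inv_pow]
  · simp only [invXY, coeff_succ_X_mul, coeff_mk]
    rw [show p + 1 + (q + 1) = (p + q + 1) + 1 by ring, Nat.choose_succ_succ,
      show p + (q + 1) = p + q + 1 by ring, show p + 1 + q = p + q + 1 by ring]
    simp only [pow_succ, coeff_one]
    push_cast
    field_simp
    simp

/-- The terms `(-x)_N (y)_N / (N! (M + 1 - x)_N)` of the Gauss hypergeometric series at `1`. -/
noncomputable def term (M : ℕ) : ℕ → BiSeries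
  | 0 => 1
  | N + 1 => term M N * ((N - varX) * (N + varY)) *
      (scal ((N + 1 : ℕ) : ℝ)⁻¹ * invX (M + 1 + N))

/-- Only the denominator depends on `M`, and `(M+1-x)(M+2-x)_N = (M+1-x)_N (M+1+N-x)`. -/
lemma term_succ_mul (M N : ℕ) : term (M + 1) N * ((M + 1 + N : ℕ) - varX) =
    ((M + 1 : ℕ) - varX) * term M N := by
  induction N with
  | zero => simp [term]
  | succ N ih =>
    have h1 := sub_mul_invX (k := M + 1 + 1 + N) (by omega)
    have h2 := sub_mul_invX (k := M + 1 + N) (by omega)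
    rw [term, term, show M + 1 + (N + 1) = M + 1 + 1 + N by ring]
    linear_combination
      term (M + 1) N * ((N - varX) * (N + varY)) * scal ((N + 1 : ℕ) : ℝ)⁻¹ * (h1 - h2) +
      ((N - varX) * (N + varY)) * scal ((N + 1 : ℕ) : ℝ)⁻¹ * invX (M + 1 + N) * ih

/-- The contiguity relation fails term by term only by a telescoping difference, so a single
boundary term remains. -/
lemma sum_range_term (M L : ℕ) :
    ((M + 1 : ℕ) - varX) * ((M + 1 : ℕ) - varY) * ∑ N ∈ Finset.range L, term M N -
      (M + 1 : ℕ) * ((M + 1 : ℕ) - varX - varY) * ∑ N ∈ Finset.range L, term (M + 1) N =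
    -(((M + 1 : ℕ) - varX) * (L * term M L)) := by
  induction L with
  | zero => simp
  | succ L ih =>
    have h1 := term_succ_mul M L
    have h2 := sub_mul_invX (k := M + 1 + L) (by omega)
    have h3 := scal_inv_mul (Nat.succ_ne_zero L)
    have h4 : ((M + 1 : ℕ) - varX) * (((L + 1 : ℕ) : BiSeries) * term M (L + 1)) =
        term (M + 1) L * ((L - varX) * (L + varY)) := by
      rw [term]
      simp only [Nat.succ_eq_add_one] at h3
      linear_combination
        ((M + 1 : ℕ) - varX) * term M L * ((L - varX) * (L + varY)) * invX (M + 1 + L) * h3 -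
        ((L - varX) * (L + varY)) * invX (M + 1 + L) * h1 +
        term (M + 1) L * ((L - varX) * (L + varY)) * h2
    rw [Finset.sum_range_succ, Finset.sum_range_succ, h4]
    push_cast at h1 ih ⊢
    linear_combination ih + (L - ((M : BiSeries) + 1 - varY)) * h1
end GaussSum

/-! ### Norm estimates and convergence of the Gauss series. -/

namespace GaussSum

/-- The weighted `ℓ¹` seminorm on `BiSeries` truncated at degree `K` in both variables, both
variables having weight `1 / 2`. -/
noncomputable def biNorm (K : ℕ) : RingSeminorm BiSeries :=
  truncSeminorm (truncSeminorm (normRingSeminorm ℝ) (1 / 2) (by norm_num) K) (1 / 2)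
    (by norm_num) K

lemma biNorm_scal (K : ℕ) (a : ℝ) : biNorm K (scal a) = |a| := by
  rw [biNorm, truncSeminorm_C, truncSeminorm_C]
  rfl

lemma biNorm_varX (K : ℕ) : biNorm K varX ≤ 1 / 2 := by
  refine (truncSeminorm_X_le _ _ _ _).trans_eq ?_
  rw [← map_one (C (R := ℝ)), truncSeminorm_C]
  change ‖(1 : ℝ)‖ * _ = _
  simp

lemma biNorm_varY (K : ℕ) : biNorm K varY ≤ 1 / 2 := by
  rw [biNorm, truncSeminorm_C]
  refine (truncSeminorm_X_le _ _ _ _).trans_eq ?_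
  change ‖(1 : ℝ)‖ * _ = _
  simp

/-- Truncation at `i + j` keeps both indices, and `2 ^ (i + j)` undoes the weights `1/2`. -/
lemma abs_coeff_le (p : BiSeries) (i j : ℕ) :
    |coeff j (coeff i p)| ≤ 2 ^ (i + j) * biNorm (i + j) p := by
  have h1 := coeff_mul_pow_le_truncSeminorm
    (truncSeminorm (normRingSeminorm ℝ) (1 / 2) (by norm_num) (i + j)) (1 / 2) (by norm_num)
    (i + j) p (Nat.le_add_right i j)
  have h2 := coeff_mul_pow_le_truncSeminorm (normRingSeminorm ℝ) (1 / 2) (by norm_num)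
    (i + j) (coeff i p) (Nat.le_add_left j i)
  change |coeff j (coeff i p)| * _ ≤ _ at h2
  have h3 := (mul_le_mul_of_nonneg_right h2 (by positivity : (0 : ℝ) ≤ (1 / 2) ^ i)).trans h1
  calc |coeff j (coeff i p)| = 2 ^ (i + j) *
        (|coeff j (coeff i p)| * (1 / 2) ^ j * (1 / 2) ^ i) := by
        rw [one_div, inv_pow, inv_pow, pow_add]
        field_simp
    _ ≤ _ := mul_le_mul_of_nonneg_left h3 (by positivity)

/-- The identity `1/(k-x) = (1 + x/(k-x))/k` bounds the norm in terms of itself; since the truncated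
norm is finite, the inequality can be solved. -/
lemma biNorm_invX (K : ℕ) {k : ℕ} (hk : k ≠ 0) : biNorm K (invX k) ≤ ((k : ℝ) - 1 / 2)⁻¹ := by
  have hk1 : (1 : ℝ) ≤ k := by exact_mod_cast Nat.one_le_iff_ne_zero.2 hk
  have h : invX k = scal (k : ℝ)⁻¹ * (1 + varX * invX k) := by
    linear_combination scal (k : ℝ)⁻¹ * sub_mul_invX hk - invX k * scal_inv_mul hk
  have h1 : biNorm K (invX k) ≤ (k : ℝ)⁻¹ * (1 + 1 / 2 * biNorm K (invX k)) := by
    conv_lhs => rw [h]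
    refine (map_mul_le_mul _ _ _).trans ?_
    rw [biNorm_scal, abs_of_nonneg (by positivity)]
    refine mul_le_mul_of_nonneg_left ((map_add_le_add _ _ _).trans (add_le_add ?_ ?_))
      (by positivity)
    · rw [← map_one C, ← map_one C, biNorm_scal, abs_one]
    · exact (map_mul_le_mul _ _ _).trans
        (mul_le_mul_of_nonneg_right (biNorm_varX K) (apply_nonneg _ _))
  rw [inv_mul_eq_div, le_div_iff₀ (by linarith)] at h1
  rw [← one_div, le_div_iff₀ (by linarith)]
  linarith

/-- The quotient is `j/(M+j) - M/(M+j) · x/(M+j-x)`: the weights add up to 1 and the last factor has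
norm at most 1. -/
lemma biNorm_sub_mul_invX (K M j : ℕ) (hj : j ≠ 0) :
    biNorm K ((j - varX) * invX (M + j)) ≤ 1 := by
  have hj1 : (1 : ℝ) ≤ j := by exact_mod_cast Nat.one_le_iff_ne_zero.2 hj
  have hM : (0 : ℝ) ≤ M := Nat.cast_nonneg M
  have hq : M + j ≠ 0 := by omega
  have h : (j - varX) * invX (M + j) =
      scal ((j : ℝ) / (M + j)) - scal ((M : ℝ) / (M + j)) * (varX * invX (M + j)) := by
    have e1 := scal_inv_mul hq
    have e2 := sub_mul_invX hq
    have e3 : ∀ a : ℕ, scal ((a : ℝ) / (M + j)) = a * scal ((M + j : ℕ) : ℝ)⁻¹ := by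
      intro a
      rw [← scal_natCast, ← map_mul, ← map_mul]
      push_cast
      rfl
    rw [e3, e3]
    push_cast at e1 e2 ⊢
    linear_combination e2 - (M : BiSeries) * scal ((M : ℝ) + j)⁻¹ * e2 +
      ((M : BiSeries) * invX (M + j) - 1) * e1
  rw [h]
  have hX : biNorm K (varX * invX (M + j)) ≤ 1 / 2 * ((M : ℝ) + j - 1 / 2)⁻¹ := by
    refine (map_mul_le_mul _ _ _).trans (mul_le_mul (biNorm_varX K) ?_ (apply_nonneg _ _)
      (by norm_num))
    exact_mod_cast biNorm_invX K hq
  calc _ ≤ (j : ℝ) / (M + j) + (M : ℝ) / (M + j) * (1 / 2 * ((M : ℝ) + j - 1 / 2)⁻¹) := by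
        refine (map_sub_le_add _ _ _).trans (add_le_add ?_ ?_)
        · rw [biNorm_scal, abs_of_nonneg (by positivity)]
        · refine (map_mul_le_mul _ _ _).trans ?_
          rw [biNorm_scal, abs_of_nonneg (by positivity)]
          exact mul_le_mul_of_nonneg_left hX (by positivity)
    _ ≤ (j : ℝ) / (M + j) + (M : ℝ) / (M + j) * 1 := by
        gcongr
        rw [mul_comm, inv_mul_le_iff₀ (by linarith)]
        linarith
    _ = 1 := by
        rw [mul_one, ← add_div, add_comm, div_self (by positivity)]

lemma biNorm_one_add_le (K j : ℕ) (hj : j ≠ 0) :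
    biNorm K ((j + varY) * scal (j : ℝ)⁻¹) ≤ 1 + (j : ℝ)⁻¹ / 2 := by
  have h : (j + varY) * scal (j : ℝ)⁻¹ = scal 1 + scal (j : ℝ)⁻¹ * varY := by
    rw [show scal 1 = 1 by simp [scal]]
    linear_combination scal_inv_mul hj
  rw [h]
  refine (map_add_le_add _ _ _).trans (add_le_add (by rw [biNorm_scal, abs_one]) ?_)
  refine (map_mul_le_mul _ _ _).trans ?_
  rw [biNorm_scal, abs_of_nonneg (by positivity)]
  exact (mul_le_mul_of_nonneg_left (biNorm_varY K) (by positivity)).trans_eq (by ring)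

/-- Induction step for `∏_{j≤N} (1 + 1/(2j)) ≤ √(2N+1)`; it reduces to `(2N+1)(2N+3) ≤ (2N+2)²`. -/
lemma one_add_mul_sqrt_le (N : ℕ) :
    (1 + ((N + 1 : ℕ) : ℝ)⁻¹ / 2) * √(2 * N + 1) ≤ √(2 * (N + 1 : ℕ) + 1) := by
  refine Real.le_sqrt_of_sq_le ?_
  rw [mul_pow, Real.sq_sqrt (by positivity)]
  push_cast
  have : (1 + ((N : ℝ) + 1)⁻¹ / 2) ^ 2 * (2 * N + 1) =
      (2 * N + 3) ^ 2 * (2 * N + 1) / (4 * (N + 1) ^ 2) := by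
    field_simp
    ring
  rw [this, div_le_iff₀ (by positivity)]
  nlinarith [(Nat.cast_nonneg N : (0 : ℝ) ≤ N)]

/-- Each `j - x` is paired with `1/(M+j-x)`, at no cost in norm, and each `j + y` with `1/j`, at a
total cost of `√(2N+1)`. The factor `-xy` from `j = 0` gives the `1/4`; the last two denominators
stay unpaired and supply the decay. -/
lemma exists_term_succ_eq (M N : ℕ) : ∃ u : BiSeries,
    term M (N + 1) = u * (scal ((N + 1 : ℕ) : ℝ)⁻¹ * invX (M + 1 + N)) ∧
      ∀ K, biNorm K u ≤ √(2 * N + 1) / 4 := by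
  induction N with
  | zero =>
    refine ⟨-(varX * varY), by simp [term], fun K => ?_⟩
    rw [map_neg_eq_map]
    refine (map_mul_le_mul _ _ _).trans
      ((mul_le_mul (biNorm_varX K) (biNorm_varY K) (apply_nonneg _ _) (by norm_num)).trans ?_)
    norm_num
  | succ N ih =>
    obtain ⟨u, hu, hK⟩ := ih
    refine ⟨u * ((((N + 1 : ℕ) : BiSeries) - varX) * invX (M + (N + 1))) *
      (((N + 1 : ℕ) + varY) * scal ((N + 1 : ℕ) : ℝ)⁻¹), ?_, fun K => ?_⟩
    · rw [term, hu, show M + 1 + N = M + (N + 1) by ring]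
      ring
    · have h1 : biNorm K (u * ((((N + 1 : ℕ) : BiSeries) - varX) * invX (M + (N + 1)))) ≤
          √(2 * N + 1) / 4 * 1 :=
        (map_mul_le_mul _ _ _).trans (mul_le_mul (hK K)
          (biNorm_sub_mul_invX K M (N + 1) (by omega)) (apply_nonneg _ _) (by positivity))
      refine (map_mul_le_mul _ _ _).trans ((mul_le_mul h1
        (biNorm_one_add_le K (N + 1) (by omega)) (apply_nonneg _ _) (by positivity)).trans ?_)
      linarith [one_add_mul_sqrt_le N]

lemma biNorm_term_succ_le (K M N : ℕ) :
    biNorm K (term M (N + 1)) ≤ √(N + 1) * ((N + 1 : ℝ)⁻¹ * (M + (N + 1) : ℝ)⁻¹) := by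
  obtain ⟨u, hu, hK⟩ := exists_term_succ_eq M N
  rw [hu]
  have h1 : biNorm K (invX (M + 1 + N)) ≤ 2 * (M + (N + 1) : ℝ)⁻¹ := by
    refine (biNorm_invX K (by omega)).trans ?_
    push_cast
    rw [← div_eq_mul_inv, ← one_div, div_le_div_iff₀ (by linarith [(Nat.cast_nonneg N : (0 : ℝ) ≤ N),
      (Nat.cast_nonneg M : (0 : ℝ) ≤ M)]) (by positivity)]
    linarith [(Nat.cast_nonneg N : (0 : ℝ) ≤ N), (Nat.cast_nonneg M : (0 : ℝ) ≤ M)]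
  have h2 : √(2 * N + 1) ≤ 2 * √(N + 1) := by
    rw [Real.sqrt_le_left (by positivity), mul_pow, Real.sq_sqrt (by positivity)]
    linarith [(Nat.cast_nonneg N : (0 : ℝ) ≤ N)]
  calc _ ≤ √(2 * N + 1) / 4 * ((N + 1 : ℝ)⁻¹ * (2 * (M + (N + 1) : ℝ)⁻¹)) := by
        refine (map_mul_le_mul _ _ _).trans (mul_le_mul (hK K) ?_ (apply_nonneg _ _)
          (by positivity))
        refine (map_mul_le_mul _ _ _).trans ?_
        rw [biNorm_scal, abs_of_nonneg (by positivity)]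
        push_cast
        exact mul_le_mul_of_nonneg_left h1 (by positivity)
    _ ≤ (2 * √(N + 1)) / 4 * ((N + 1 : ℝ)⁻¹ * (2 * (M + (N + 1) : ℝ)⁻¹)) := by gcongr
    _ = _ := by ring

lemma summable_sqrt_mul_inv_mul_inv :
    Summable fun N : ℕ => √(N + 1 : ℝ) * ((N + 1 : ℝ)⁻¹ * (N + 1 : ℝ)⁻¹) := by
  have h := (summable_nat_add_iff 1).2 (Real.summable_nat_rpow_inv (p := 3 / 2).2 (by norm_num))
  refine h.congr fun N => ?_
  have hN : (0 : ℝ) < N + 1 := by positivity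
  push_cast
  rw [← Real.rpow_neg hN.le, ← mul_inv, ← sq, Real.sqrt_eq_rpow, ← Real.rpow_natCast _ 2,
    ← Real.rpow_neg hN.le, ← Real.rpow_add hN]
  norm_num

lemma abs_coeff_term_succ_le (M N i j : ℕ) : |coeff j (coeff i (term M (N + 1)))| ≤
    2 ^ (i + j) * (√(N + 1) * ((N + 1 : ℝ)⁻¹ * (N + 1 : ℝ)⁻¹)) := by
  refine (abs_coeff_le _ i j).trans (mul_le_mul_of_nonneg_left
    ((biNorm_term_succ_le _ M N).trans ?_) (by positivity))
  refine mul_le_mul_of_nonneg_left (mul_le_mul_of_nonneg_left (inv_anti₀ (by positivity) ?_)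
    (by positivity)) (by positivity)
  linarith [(Nat.cast_nonneg M : (0 : ℝ) ≤ M)]

lemma summable_term_succ (M : ℕ) : Summable fun N => term M (N + 1) := by
  rw [WithPiTopology.summable_iff_summable_coeff]
  intro i
  rw [WithPiTopology.summable_iff_summable_coeff]
  intro j
  exact (summable_sqrt_mul_inv_mul_inv.mul_left (2 ^ (i + j))).of_norm_bounded
    fun N => abs_coeff_term_succ_le M N i j

lemma summable_term (M : ℕ) : Summable (term M) :=
  (summable_nat_add_iff 1).1 (summable_term_succ M)

lemma tendsto_iff_coeff {ι : Type*} {l : Filter ι} (f : ι → BiSeries) (g : BiSeries) :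
    Tendsto f l (𝓝 g) ↔
      ∀ i j, Tendsto (fun a => coeff j (coeff i (f a))) l (𝓝 (coeff j (coeff i g))) := by
  rw [WithPiTopology.tendsto_iff_coeff_tendsto]
  exact forall_congr' fun i => WithPiTopology.tendsto_iff_coeff_tendsto ..

lemma coeff_tsum {f : ℕ → BiSeries} (hf : Summable f) (i j : ℕ) :
    HasSum (fun N => coeff j (coeff i (f N))) (coeff j (coeff i (∑' N, f N))) := by
  have h := hf.hasSum
  rw [WithPiTopology.hasSum_iff_hasSum_coeff] at h
  have h' := h i
  rw [WithPiTopology.hasSum_iff_hasSum_coeff] at h'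
  exact h' j

lemma tendsto_natCast_mul_term (M : ℕ) :
    Tendsto (fun L : ℕ => (L : BiSeries) * term M L) atTop (𝓝 0) := by
  rw [tendsto_iff_coeff]
  intro i j
  -- The term bound is of order `N^(-3/2)` at index `N = L + 1`, so multiplying by the index leaves
  -- `(L+1)^(-1/2)`.
  rw [← tendsto_add_atTop_iff_nat 1]
  simp only [map_zero]
  have h : Tendsto (fun L : ℕ => 2 ^ (i + j) * (√(L + 1 : ℝ))⁻¹) atTop (𝓝 0) := by
    rw [← mul_zero ((2 : ℝ) ^ (i + j))]
    refine Tendsto.const_mul _ (tendsto_inv_atTop_zero.comp (Real.tendsto_sqrt_atTop.comp ?_))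
    exact tendsto_atTop_add_const_right _ _ tendsto_natCast_atTop_atTop
  refine squeeze_zero_norm (fun L => ?_) h
  rw [← scal_natCast, coeff_C_mul, coeff_C_mul, norm_mul, Real.norm_eq_abs, Real.norm_eq_abs,
    Nat.abs_cast]
  refine (mul_le_mul_of_nonneg_left (abs_coeff_term_succ_le M L i j) (by positivity)).trans_eq ?_
  have hs : √(L + 1 : ℝ) ^ 2 = L + 1 := Real.sq_sqrt (by positivity)
  have hs0 : √(L + 1 : ℝ) ≠ 0 := (Real.sqrt_pos.2 (by positivity)).ne'
  push_cast
  rw [← hs]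
  rw [Real.sqrt_sq (by positivity)]
  field_simp

/-- Contiguity of the Gauss hypergeometric series at `1`. -/
lemma tsum_term_contiguous (M : ℕ) :
    ((M + 1 : ℕ) - varX) * ((M + 1 : ℕ) - varY) * ∑' N, term M N =
      (M + 1 : ℕ) * ((M + 1 : ℕ) - varX - varY) * ∑' N, term (M + 1) N := by
  have h1 := ((summable_term M).hasSum.tendsto_sum_nat.const_mul
    (((M + 1 : ℕ) - varX) * ((M + 1 : ℕ) - varY))).sub
    ((summable_term (M + 1)).hasSum.tendsto_sum_nat.const_mul
      ((M + 1 : ℕ) * ((M + 1 : ℕ) - varX - varY)))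
  have h2 := ((tendsto_natCast_mul_term M).const_mul ((M + 1 : ℕ) - varX)).neg
  rw [mul_zero, neg_zero] at h2
  simp only [sum_range_term] at h1
  exact sub_eq_zero.1 (tendsto_nhds_unique h1 h2)

/-- Dominated convergence: the bound on the terms with `N ≥ 1` is uniform in `M`, and each of them
tends to 0; the term 1 at `N = 0` survives. -/
lemma tendsto_tsum_term : Tendsto (fun M => ∑' N, term M N) atTop (𝓝 1) := by
  have h : ∀ M, ∑' N, term M N = 1 + ∑' N, term M (N + 1) := fun M =>
    (summable_term M).tsum_eq_zero_add
  simp only [h]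
  suffices H : Tendsto (fun M => ∑' N, term M (N + 1)) atTop (𝓝 0) by
    simpa using H.const_add 1
  rw [tendsto_iff_coeff]
  intro i j
  simp only [← fun M => (coeff_tsum (summable_term_succ M) i j).tsum_eq, map_zero]
  rw [← tsum_zero (β := ℕ)]
  refine tendsto_tsum_of_dominated_convergence
    (summable_sqrt_mul_inv_mul_inv.mul_left (2 ^ (i + j))) (fun N => ?_)
    (Eventually.of_forall fun M N => abs_coeff_term_succ_le M N i j)
  refine squeeze_zero_norm (fun M => (abs_coeff_le _ i j).trans (mul_le_mul_of_nonneg_left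
    (biNorm_term_succ_le _ M N) (by positivity))) ?_
  rw [← mul_zero ((2 : ℝ) ^ (i + j)), ← mul_zero √(N + 1 : ℝ), ← mul_zero (N + 1 : ℝ)⁻¹]
  refine Tendsto.const_mul _ (Tendsto.const_mul _ (Tendsto.const_mul _
    (tendsto_inv_atTop_zero.comp ?_)))
  exact tendsto_atTop_add_const_right _ _ tendsto_natCast_atTop_atTop

/-! ### The product side of Gauss's theorem. -/

/-- The partial products of `∏ k (k - x - y) / ((k - x) (k - y))`. -/
noncomputable def gammaProd : ℕ → BiSeries
  | 0 => 1
  | M + 1 => gammaProd M * ((M + 1 : ℕ) * ((M + 1 : ℕ) - varX - varY)) *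
      (invX (M + 1) * invY (M + 1))

lemma tsum_term_zero_eq (M : ℕ) : ∑' N, term 0 N = gammaProd M * ∑' N, term M N := by
  induction M with
  | zero => simp [gammaProd]
  | succ M ih =>
    have h1 := sub_mul_invX (Nat.succ_ne_zero M)
    have h2 := sub_mul_invY (Nat.succ_ne_zero M)
    have h3 := tsum_term_contiguous M
    rw [ih, gammaProd]
    simp only [Nat.succ_eq_add_one] at h1 h2
    generalize ∑' N, term M N = a at *
    generalize ∑' N, term (M + 1) N = b at *
    linear_combination gammaProd M * invX (M + 1) * invY (M + 1) * h3 -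
      gammaProd M * a * (((M + 1 : ℕ) - varY) * invY (M + 1)) * h1 - gammaProd M * a * h2

/-- The Gauss summation theorem for formal series: a limit of the partial products is the sum. -/
lemma eq_tsum_term_of_tendsto {F : BiSeries} (h : Tendsto gammaProd atTop (𝓝 F)) :
    F = ∑' N, term 0 N := by
  have h1 := h.mul tendsto_tsum_term
  simp only [← tsum_term_zero_eq, mul_one] at h1
  exact tendsto_nhds_unique h1 tendsto_const_nhds

end GaussSum

/-! ### The weight grading on products of zeta values. -/

lemma mul_mem_span_zetaProducts {v w : ℕ} {a b : ℂ} (ha : a ∈ Submodule.span ℚ (zetaProducts v))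
    (hb : b ∈ Submodule.span ℚ (zetaProducts w)) :
    a * b ∈ Submodule.span ℚ (zetaProducts (v + w)) := by
  have h := Submodule.mul_mem_mul ha hb
  rw [Submodule.span_mul_span] at h
  refine Submodule.span_mono ?_ h
  rintro _ ⟨_, ⟨K, hK, rfl, rfl⟩, _, ⟨K', hK', rfl, rfl⟩, rfl⟩
  refine ⟨K + K', fun k hk => ?_, Multiset.sum_add _ _, by simp⟩
  exact (Multiset.mem_add.1 hk).elim (hK k) (hK' k)

lemma riemannZeta_mem_span_zetaProducts {k : ℕ} (hk : 2 ≤ k) :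
    riemannZeta k ∈ Submodule.span ℚ (zetaProducts k) :=
  Submodule.subset_span ⟨{k}, by simpa using hk, by simp, by simp⟩

lemma one_mem_span_zetaProducts : (1 : ℂ) ∈ Submodule.span ℚ (zetaProducts 0) :=
  Submodule.subset_span ⟨0, by simp, by simp, by simp⟩

lemma span_zetaProducts_le_adjoin (w : ℕ) : Submodule.span ℚ (zetaProducts w) ≤
    Subalgebra.toSubmodule
      (Algebra.adjoin ℚ ((fun k : ℕ => riemannZeta (k : ℂ)) '' Set.Icc 2 w)) := by
  rw [Submodule.span_le]
  rintro _ ⟨K, hK, rfl, rfl⟩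
  refine Subalgebra.multiset_prod_mem _ fun z hz => ?_
  obtain ⟨k, hk, rfl⟩ := Multiset.mem_map.1 hz
  exact Algebra.subset_adjoin ⟨k, ⟨hK k hk, Multiset.single_le_sum (fun _ _ => Nat.zero_le _) k hk⟩,
    rfl⟩

lemma ofReal_tsum_inv_pow {k : ℕ} (hk : 2 ≤ k) :
    ((∑' n : ℕ, ((n + 1 : ℕ) : ℝ)⁻¹ ^ k : ℝ) : ℂ) = riemannZeta k := by
  have hs : Summable fun n : ℕ => (1 : ℂ) / (n : ℂ) ^ k := by
    have := Real.summable_one_div_nat_pow.2 (show 1 < k by omega)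
    simpa using Complex.ofRealCLM.summable this
  rw [zeta_nat_eq_tsum_of_gt_one (by omega), hs.tsum_eq_zero_add, Complex.ofReal_tsum]
  simp [show k ≠ 0 by omega]

lemma tendsto_sum_inv_pow {k : ℕ} (hk : 2 ≤ k) :
    Tendsto (fun M => ∑ n ∈ Finset.range M, ((n + 1 : ℕ) : ℝ)⁻¹ ^ k) atTop
      (𝓝 (∑' n : ℕ, ((n + 1 : ℕ) : ℝ)⁻¹ ^ k)) := by
  refine Summable.tendsto_sum_tsum_nat ?_
  simp only [inv_pow]
  exact (summable_nat_add_iff 1).2 (Real.summable_nat_pow_inv.2 (show 1 < k by omega))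

lemma PowerSeries.derivative_mul {R : Type*} [CommRing R] (f g : R⟦X⟧) :
    d⁄dX R (f * g) = f * d⁄dX R g + g * d⁄dX R f := by
  rw [Derivation.leibniz, smul_eq_mul, smul_eq_mul]

/-! ### Logarithmic derivative and coefficients of the product. -/

namespace GaussSum

lemma derivative_natCast (k : ℕ) : d⁄dX ℝ⟦X⟧ (k : BiSeries) = 0 := by
  rw [← scal_natCast, derivative_C]

lemma derivative_invX {k : ℕ} (hk : k ≠ 0) : d⁄dX ℝ⟦X⟧ (invX k) = invX k ^ 2 := by
  have h := sub_mul_invX hk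
  have h1 := congrArg (d⁄dX ℝ⟦X⟧) h
  rw [derivative_mul, map_sub, derivative_natCast, derivative_X, derivative_one] at h1
  linear_combination invX k * h1 - d⁄dX ℝ⟦X⟧ (invX k) * h

/-- The logarithmic derivative of `gammaProd` with respect to `x`. -/
noncomputable def logDeriv (M : ℕ) : BiSeries :=
  ∑ k ∈ Finset.range M, (invX (k + 1) - invXY (k + 1))

lemma derivative_gammaProd (M : ℕ) :
    d⁄dX ℝ⟦X⟧ (gammaProd M) = gammaProd M * logDeriv M := by
  induction M with
  | zero => simp [gammaProd, logDeriv]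
  | succ M ih =>
    have h1 := sub_mul_invX (Nat.succ_ne_zero M)
    have h2 := sub_mul_invXY (Nat.succ_ne_zero M)
    simp only [Nat.succ_eq_add_one] at h1 h2
    rw [gammaProd, logDeriv, Finset.sum_range_succ, ← logDeriv, invY]
    simp only [derivative_mul, map_sub, derivative_natCast, derivative_X, derivative_C, ih,
      derivative_invX (Nat.succ_ne_zero M)]
    generalize (C _ : BiSeries) = b
    linear_combination gammaProd M * (M + 1 : ℕ) * invX (M + 1) * b * h2

/-- At `q = 0` the two inverses agree and cancel, which removes the divergent harmonic sum at `p = q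
= 0`. -/
lemma coeff_logDeriv (M p q : ℕ) : coeff q (coeff p (logDeriv M)) =
    if q = 0 then 0 else
      -((p + q).choose p : ℝ) * ∑ k ∈ Finset.range M, ((k + 1 : ℕ) : ℝ)⁻¹ ^ (p + q + 1) := by
  simp only [logDeriv, map_sum, map_sub, invX, invXY, coeff_mk, coeff_C]
  split_ifs with h
  · subst h
    simp
  · rw [Finset.mul_sum]
    exact Finset.sum_congr rfl fun k _ => by ring

lemma exists_tendsto_coeff_logDeriv (p q : ℕ) : ∃ l : ℝ,
    (l : ℂ) ∈ Submodule.span ℚ (zetaProducts (p + q + 1)) ∧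
      Tendsto (fun M => coeff q (coeff p (logDeriv M))) atTop (𝓝 l) := by
  simp only [coeff_logDeriv]
  split_ifs with h
  · exact ⟨0, by simp, tendsto_const_nhds⟩
  · have hk : 2 ≤ p + q + 1 := by omega
    refine ⟨_, ?_, (tendsto_sum_inv_pow hk).const_mul _⟩
    rw [Complex.ofReal_mul, ofReal_tsum_inv_pow hk]
    have := Submodule.smul_mem _ (-((p + q).choose p : ℚ)) (riemannZeta_mem_span_zetaProducts hk)
    rw [Algebra.smul_def] at this
    simpa using this

/-- At `x = 0` every factor is `k(k-y)/(k(k-y))`. This is the initial condition for the differential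
equation. -/
lemma coeff_zero_gammaProd (M : ℕ) : coeff 0 (gammaProd M) = 1 := by
  induction M with
  | zero => simp [gammaProd]
  | succ M ih =>
    have h1 := congrArg (coeff 0) (sub_mul_invX (Nat.succ_ne_zero M))
    have h2 := congrArg (coeff 0) (sub_mul_invY (Nat.succ_ne_zero M))
    simp only [coeff_zero_eq_constantCoeff_apply, map_mul, map_sub, map_natCast, map_one,
      constantCoeff_X, constantCoeff_C, Nat.succ_eq_add_one] at h1 h2 ih
    simp only [coeff_zero_eq_constantCoeff_apply, gammaProd, map_mul, map_sub, map_natCast, ih,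
      constantCoeff_X, constantCoeff_C]
    linear_combination h2 * (((M + 1 : ℕ) : ℝ⟦X⟧) * constantCoeff (invX (M + 1))) + h1

/-- Comparing coefficients in `∂ₓG = G · L` expresses `p + 1` times the coefficient at `p + 1`
through coefficients of `G` at most `p` in `x`; the extra 1 in the weight of `L` matches the degree
lost by differentiating. -/
lemma exists_tendsto_coeff_gammaProd (p : ℕ) : ∀ q, ∃ l : ℝ,
    (l : ℂ) ∈ Submodule.span ℚ (zetaProducts (p + q)) ∧
      Tendsto (fun M => coeff q (coeff p (gammaProd M))) atTop (𝓝 l) := by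
  induction p using Nat.strong_induction_on with
  | _ p ih =>
    intro q
    rcases p with _ | p
    · simp only [coeff_zero_gammaProd, coeff_one]
      refine ⟨_, ?_, tendsto_const_nhds⟩
      split_ifs with h
      · simpa [h] using one_mem_span_zetaProducts
      · simp
    · choose! c hc hct using ih
      choose g hg hgt using exists_tendsto_coeff_logDeriv
      have hrec : ∀ M, coeff q (coeff (p + 1) (gammaProd M)) = ((p : ℝ) + 1)⁻¹ *
          ∑ a ∈ Finset.HasAntidiagonal.antidiagonal p, ∑ b ∈ Finset.HasAntidiagonal.antidiagonal q,
            coeff b.1 (coeff a.1 (gammaProd M)) * coeff b.2 (coeff a.2 (logDeriv M)) := by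
        intro M
        have h := congrArg (fun f => coeff q (coeff p f)) (derivative_gammaProd M)
        simp only [coeff_derivative] at h
        rw [← Nat.cast_succ, ← map_natCast (C (R := ℝ)), coeff_mul_C] at h
        simp only [coeff_mul, map_sum] at h
        rw [← h, Nat.cast_succ, mul_comm (coeff q _), inv_mul_cancel_left₀ (by positivity)]
      simp only [hrec]
      refine ⟨_, ?_, Tendsto.const_mul _ (tendsto_finsetSum _ fun a ha =>
        tendsto_finsetSum _ fun b hb => (hct a.1 ?_ b.1).mul (hgt a.2 b.2))⟩
      · rw [Complex.ofReal_mul, Complex.ofReal_sum]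
        have : (∑ a ∈ Finset.HasAntidiagonal.antidiagonal p,
            ((∑ b ∈ Finset.HasAntidiagonal.antidiagonal q, c a.1 b.1 * g a.2 b.2 : ℝ) : ℂ)) ∈
              Submodule.span ℚ (zetaProducts (p + 1 + q)) := by
          refine Submodule.sum_mem _ fun a ha => ?_
          rw [Complex.ofReal_sum]
          refine Submodule.sum_mem _ fun b hb => ?_
          rw [Finset.HasAntidiagonal.mem_antidiagonal] at ha hb
          rw [Complex.ofReal_mul, show p + 1 + q = (a.1 + b.1) + (a.2 + b.2 + 1) by omega]
          exact mul_mem_span_zetaProducts (hc _ (by omega) _) (hg _ _)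
        have h := Submodule.smul_mem _ ((p : ℚ) + 1)⁻¹ this
        rw [Algebra.smul_def] at h
        simpa using h
      · rw [Finset.HasAntidiagonal.mem_antidiagonal] at ha
        omega

/-- The coefficients of the Gauss series are rational combinations of products of zeta values. -/
lemma coeff_tsum_term_mem (p q : ℕ) : ((coeff q (coeff p (∑' N, term 0 N)) : ℝ) : ℂ) ∈
    Submodule.span ℚ (zetaProducts (p + q)) := by
  choose c hc hct using exists_tendsto_coeff_gammaProd
  have h : Tendsto gammaProd atTop (𝓝 (mk fun p => mk fun q => c p q)) := by
    rw [tendsto_iff_coeff]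
    simpa only [coeff_mk] using hct
  rw [← eq_tsum_term_of_tendsto h, coeff_mk, coeff_mk]
  exact hc p q

end GaussSum

/-! ### Coefficients of the Gauss series as nested sums. -/

namespace GaussSum

/-- For `M = 0` the Pochhammer symbols in `x` cancel down to `-x/(N+1-x)`, while `(y)_{N+1}/(N+1)! =
y/(N+1) · ∏_{j≤N} (1 + y/j)`. -/
lemma term_zero_succ_eq (N : ℕ) : term 0 (N + 1) = -(varX * (invX (N + 1) *
    C (C ((N + 1 : ℕ) : ℝ)⁻¹ * (X * ∏ j ∈ Finset.Icc 1 N, (1 + C ((j : ℕ) : ℝ)⁻¹ * X))))) := by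
  induction N with
  | zero =>
    have h : scal ((0 + 1 : ℕ) : ℝ)⁻¹ = 1 := by simp [scal]
    simp only [term, map_mul, h]
    simp
    ring
  | succ N ih =>
    have h1 := sub_mul_invX (Nat.succ_ne_zero N)
    have h2 := scal_inv_mul (Nat.succ_ne_zero N)
    rw [term, ih, Finset.prod_Icc_succ_top (by omega)]
    generalize ∏ j ∈ Finset.Icc 1 N, (1 + C ((j : ℕ) : ℝ)⁻¹ * (X : ℝ⟦X⟧)) = P
    rw [show 0 + 1 + (N + 1) = N + 1 + 1 by ring]
    simp only [map_mul, map_add, map_one, Nat.succ_eq_add_one] at h1 h2 ⊢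
    linear_combination
      -(varX * varY * C P * scal ((N + 1 + 1 : ℕ) : ℝ)⁻¹ * invX (N + 1 + 1) *
        (scal ((N + 1 : ℕ) : ℝ)⁻¹ * ((N + 1 : ℕ) + varY))) * h1 -
      varX * varY * C P * scal ((N + 1 + 1 : ℕ) : ℝ)⁻¹ * invX (N + 1 + 1) * h2

lemma coeff_prod_one_add (s : Finset ℕ) (n : ℕ) :
    coeff n (∏ j ∈ s, (1 + C ((j : ℕ) : ℝ)⁻¹ * (X : ℝ⟦X⟧))) =
      ∑ t ∈ s.powersetCard n, ∏ j ∈ t, (j : ℝ)⁻¹ := by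
  rw [Finset.prod_one_add, map_sum, Finset.powersetCard_eq_filter, Finset.sum_filter]
  refine Finset.sum_congr rfl fun t _ => ?_
  rw [Finset.prod_mul_distrib, Finset.prod_const, ← map_prod, coeff_C_mul, coeff_X_pow]
  simp [eq_comm]

lemma coeff_term_zero_succ (N m n : ℕ) : coeff (n + 1) (coeff (m + 1) (term 0 (N + 1))) =
    -(((N + 1 : ℕ) : ℝ)⁻¹ ^ (m + 2) *
      ∑ t ∈ (Finset.Icc 1 N).powersetCard n, ∏ j ∈ t, (j : ℝ)⁻¹) := by
  rw [term_zero_succ_eq, map_neg, map_neg, coeff_succ_X_mul, coeff_mul_C, invX, coeff_mk,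
    ← mul_assoc, ← map_mul, coeff_C_mul, coeff_succ_X_mul, coeff_prod_one_add]
  ring

lemma coeff_term_zero_zero (m n : ℕ) : coeff (n + 1) (coeff (m + 1) (term 0 0)) = 0 := by
  simp [term, coeff_one]

lemma hasSum_coeff_term (m n : ℕ) :
    HasSum (fun N : ℕ => ((N + 1 : ℕ) : ℝ)⁻¹ ^ (m + 2) *
      ∑ t ∈ (Finset.Icc 1 N).powersetCard n, ∏ j ∈ t, (j : ℝ)⁻¹)
      (-coeff (n + 1) (coeff (m + 1) (∑' N, term 0 N))) := by
  have h := coeff_tsum (summable_term 0) (m + 1) (n + 1)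
  rw [← hasSum_nat_add_iff' 1, Finset.sum_range_one, coeff_term_zero_zero, sub_zero] at h
  simpa only [coeff_term_zero_succ, neg_neg] using h.neg

end GaussSum

/-! ### Reindexing nested sums by largest entry and remaining set. -/

/-- The nested index with largest entry `N + 1` and the other entries forming the set `t`. -/
def NestedIndex.ofFinset (n : ℕ) (a : Σ N : ℕ, (Finset.Icc 1 N).powersetCard n) :
    NestedIndex (n + 1) :=
  ⟨Fin.cons (a.1 + 1) fun i =>
      a.2.1.orderEmbOfFin (Finset.mem_powersetCard.1 a.2.2).2 (Fin.rev i), by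
    have hmem : ∀ i, a.2.1.orderEmbOfFin (Finset.mem_powersetCard.1 a.2.2).2 i ∈
        Finset.Icc 1 a.1 := fun i =>
      (Finset.mem_powersetCard.1 a.2.2).1 (Finset.orderEmbOfFin_mem _ _ _)
    constructor
    · intro i j hij
      induction j using Fin.cases with
      | zero => exact absurd hij (Fin.not_lt_zero i)
      | succ j =>
        induction i using Fin.cases with
        | zero =>
          simp only [Fin.cons_zero, Fin.cons_succ]
          have := (Finset.mem_Icc.1 (hmem (Fin.rev j))).2
          omega
        | succ i =>
          simp only [Fin.cons_succ, OrderEmbedding.lt_iff_lt, Fin.rev_lt_rev]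
          exact Fin.succ_lt_succ_iff.1 hij
    · intro j
      induction j using Fin.cases with
      | zero => simp
      | succ j =>
        simp only [Fin.cons_succ]
        exact (Finset.mem_Icc.1 (hmem (Fin.rev j))).1⟩

lemma NestedIndex.ofFinset_bijective (n : ℕ) : Function.Bijective (NestedIndex.ofFinset n) := by
  constructor
  · rintro ⟨N, t, ht⟩ ⟨N', t', ht'⟩ h
    have h := congrArg Subtype.val h
    simp only [NestedIndex.ofFinset, Fin.cons_inj] at h
    obtain ⟨h0, h⟩ := h
    obtain rfl : N = N' := by omega
    have hr : (t : Set ℕ) = t' := by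
      rw [← Finset.range_orderEmbOfFin t (Finset.mem_powersetCard.1 ht).2,
        ← Finset.range_orderEmbOfFin t' (Finset.mem_powersetCard.1 ht').2]
      congr 1
      funext i
      simpa using congrFun h (Fin.rev i)
    obtain rfl : t = t' := Finset.coe_injective hr
    rfl
  · rintro ⟨f, hf, hpos⟩
    have hinj : Function.Injective fun i : Fin n => f i.succ :=
      hf.injective.comp (Fin.succ_injective n)
    have hcard : (Finset.univ.image fun i : Fin n => f i.succ).card = n := by
      rw [Finset.card_image_of_injective _ hinj, Finset.card_univ, Fintype.card_fin]
    -- The largest entry is encoded as `N + 1`; positivity of `f 0` makes the truncated subtraction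
    -- exact.
    refine ⟨⟨f 0 - 1, Finset.univ.image fun i : Fin n => f i.succ,
      Finset.mem_powersetCard.2 ⟨fun x hx => ?_, hcard⟩⟩, ?_⟩
    · obtain ⟨i, -, rfl⟩ := Finset.mem_image.1 hx
      have h1 := hf (Fin.succ_pos i)
      have h2 := hpos i.succ
      rw [Finset.mem_Icc]
      omega
    · refine Subtype.ext ?_
      have hu := Finset.orderEmbOfFin_unique hcard (f := fun i => f (Fin.rev i).succ)
        (fun i => Finset.mem_image_of_mem _ (Finset.mem_univ _))
        (fun i j hij => hf (Fin.succ_lt_succ_iff.2 (Fin.rev_lt_rev.2 hij)))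
      funext j
      induction j using Fin.cases with
      | zero =>
        simp only [NestedIndex.ofFinset, Fin.cons_zero]
        have := hpos 0
        omega
      | succ j => simp only [NestedIndex.ofFinset, Fin.cons_succ, ← hu, Fin.rev_rev]

lemma multipleZetaTerm_ofFinset (s n : ℕ) (a : Σ N : ℕ, (Finset.Icc 1 N).powersetCard n) :
    multipleZetaTerm (consOnes s n) (NestedIndex.ofFinset n a) =
      ((((a.1 + 1 : ℕ) : ℝ)⁻¹ ^ s * ∏ j ∈ a.2.1, (j : ℝ)⁻¹ : ℝ) : ℂ) := by
  have hc := (Finset.mem_powersetCard.1 a.2.2).2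
  rw [multipleZetaTerm, Fin.prod_univ_succ]
  simp only [NestedIndex.ofFinset, consOnes, Fin.cons_zero, Fin.cons_succ, pow_one]
  have h : ∏ i : Fin n, ((a.2.1.orderEmbOfFin hc (Fin.rev i) : ℕ) : ℂ)⁻¹ =
      ∏ j ∈ a.2.1, (j : ℂ)⁻¹ := by
    rw [← Equiv.prod_comp Fin.revPerm]
    simp only [Fin.revPerm_apply, Fin.rev_rev]
    conv_rhs => rw [← Finset.map_orderEmbOfFin_univ a.2.1 hc, Finset.prod_map]
    rfl
  rw [h]
  push_cast
  rw [inv_pow]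

lemma hasSum_multipleZetaTerm (m n : ℕ) :
    HasSum (multipleZetaTerm (consOnes (m + 2) n))
      (((-coeff (n + 1) (coeff (m + 1) (∑' N, GaussSum.term 0 N)) : ℝ)) : ℂ) := by
  rw [← (Equiv.ofBijective _ (NestedIndex.ofFinset_bijective n)).hasSum_iff]
  simp only [Function.comp_def, Equiv.ofBijective_apply, multipleZetaTerm_ofFinset]
  rw [Complex.hasSum_ofReal]
  have hf : ∀ N : ℕ, ∑' t : (Finset.Icc 1 N).powersetCard n,
      ((N + 1 : ℕ) : ℝ)⁻¹ ^ (m + 2) * ∏ j ∈ t.1, (j : ℝ)⁻¹ =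
      ((N + 1 : ℕ) : ℝ)⁻¹ ^ (m + 2) *
        ∑ t ∈ (Finset.Icc 1 N).powersetCard n, ∏ j ∈ t, (j : ℝ)⁻¹ := by
    intro N
    rw [tsum_fintype, ← Finset.mul_sum,
      Finset.sum_coe_sort ((Finset.Icc 1 N).powersetCard n) fun t => ∏ j ∈ t, (j : ℝ)⁻¹]
  have hN := GaussSum.hasSum_coeff_term m n
  have hs : Summable fun a : Σ N : ℕ, (Finset.Icc 1 N).powersetCard n =>
      ((a.1 + 1 : ℕ) : ℝ)⁻¹ ^ (m + 2) * ∏ j ∈ a.2.1, (j : ℝ)⁻¹ := by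
    -- Nonnegative terms allow absolute summability to be checked on the finite fibres of fixed `N`.
    rw [summable_sigma_of_nonneg fun a =>
      mul_nonneg (by positivity) (Finset.prod_nonneg fun j _ => by positivity)]
    refine ⟨fun N => (hasSum_fintype _).summable, ?_⟩
    simpa only [hf] using hN.summable
  have ht := hs.tsum_sigma
  simp only [hf, hN.tsum_eq] at ht
  exact ht ▸ hs.hasSum

theorem mainTheorem10 (s n : ℕ) (hs : 2 ≤ s) :
    Summable (multipleZetaTerm (consOnes s n)) ∧
    multipleZeta (consOnes s n) ∈
      Algebra.adjoin ℚ ((fun k : ℕ => riemannZeta (k : ℂ)) '' Set.Icc 2 (s + n)) ∧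
    multipleZeta (consOnes s n) ∈ Submodule.span ℚ (zetaProducts (s + n)) := by
  obtain ⟨m, rfl⟩ := Nat.exists_eq_add_of_le' hs
  have hsum := hasSum_multipleZetaTerm m n
  have hmem : multipleZeta (consOnes (m + 2) n) ∈
      Submodule.span ℚ (zetaProducts (m + 2 + n)) := by
    rw [multipleZeta, hsum.tsum_eq, Complex.ofReal_neg, show m + 2 + n = m + 1 + (n + 1) by ring]
    exact Submodule.neg_mem _ (GaussSum.coeff_tsum_term_mem (m + 1) (n + 1))
  exact ⟨hsum.summable, span_zetaProducts_le_adjoin _ hmem, hmem⟩
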